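/- Let $k$ be a field and let $A$ be an associative unital $k$-algebra, with enveloping algebra $A^e=A\otimes_k A^{\mathrm{op}}$, such that $\operatorname{pdim}_{A^e}A\le 1$. For an $A$-bimodule $N$ (with $k$ acting centrally) write $H^n(A,N)=\operatorname{Ext}^n_{A^e}(A,N)$. Let $x\in A$ be normal (that is, $Ax=xA$) and not a divisor of zero (on either side), and let $\alpha$ be the $k$-algebra automorphism of $A$ with $ax=x\alpha(a)$ for all $a\in A$. Put $B=A/(x)$, and denote also by $\alpha$ the automorphism of $B$ induced by $\alpha$. For a $B$-bimodule $M$ and an automorphism $\sigma$ of $B$, let $M_\sigma$ be the $B$-bimodule which coincides with $M$ as a left module and whose right action is $m\cdot b=m\,\sigma(b)$; $B$-bimodules are regarded as $A$-bimodules along $A\to B$. Then for each $p\ge 0$ and each $B$-bimodule $M$ there is an exact sequence of $k$-vector spaces $$0\to H^{2p+1}(B,M)\to H^1(A,M_{\alpha^{p}})\to H^0(A,M_{\alpha^{p+1}})\to H^{2p+2}(B,M)\to 0,$$ and, for each fixed $p$, these sequences can be chosen natural in $M$. -/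

import Mathlib

open CategoryTheory
open scoped TensorProduct

universe u v

namespace HochschildNormal

section Bimodules

variable (k : Type u) [Field k] (A : Type v) [Ring A] [Algebra k A]

/-- The enveloping algebra `Aᵉ = A ⊗ₖ Aᵒᵖ`. -/
abbrev Env : Type v := A ⊗[k] Aᵐᵒᵖ

/-- The category of `A`-bimodules (with central action of `k`), as left `Aᵉ`-modules;
`a • m • b` is `(a ⊗ₜ op b) • m`. -/
abbrev Bimod := ModuleCat.{v} (Env k A)

/-- The `Aᵉ`-module structure of `A`. -/
abbrev regularModule : Module (Env k A) A := TensorProduct.Algebra.module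

theorem regularModule_smul (a b c : A) :
    letI := regularModule k A
    ((a ⊗ₜ[k] MulOpposite.op b : Env k A) • c : A) = a * c * b := by
  let := regularModule k A
  change a • (MulOpposite.op b • c) = a * c * b
  simp [mul_assoc]

/-- `A` as a bimodule over itself. -/
def regularBimod : Bimod k A :=
  letI := regularModule k A
  ModuleCat.of (Env k A) A

/-- Hochschild cohomology `Hⁿ(A, M) = Extⁿ_{Aᵉ}(A, M)`, as a functor of the bimodule `M` with
values in `k`-vector spaces. -/
noncomputable def hochschild (n : ℕ) : Bimod k A ⥤ ModuleCat.{v} k where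
  obj M := ModuleCat.of k (Abelian.Ext (regularBimod k A) M n)
  map φ := ModuleCat.ofHom
    ((Abelian.Ext.mk₀ φ).postcompOfLinear k (regularBimod k A) (add_zero n))
  map_id M := by
    ext y
    simp [Abelian.Ext.postcompOfLinear]
  map_comp φ ψ := by
    ext y
    simp [Abelian.Ext.postcompOfLinear]

end Bimodules

section Restriction

variable {k : Type u} [Field k] {A B : Type v} [Ring A] [Algebra k A] [Ring B] [Algebra k B]

/-- For algebra maps `f g : A → B`, a `B`-bimodule `M` becomes an `A`-bimodule with
`a • m • b = f a • m • g b`. -/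
noncomputable def restrictBimod (f g : A →ₐ[k] B) : Bimod k B ⥤ Bimod k A :=
  ModuleCat.restrictScalars (Algebra.TensorProduct.map f (AlgHom.op g)).toRingHom

theorem restrictBimod_smul (f g : A →ₐ[k] B) (M : Bimod k B) (a b : A) (m : M) :
    ((a ⊗ₜ[k] MulOpposite.op b : Env k A) • (show (restrictBimod f g).obj M from m) :
      (restrictBimod f g).obj M) = (f a ⊗ₜ[k] MulOpposite.op (g b) : Env k B) • m :=
  rfl

/-- A `B`-bimodule seen as an `A`-bimodule along an algebra map `A → B`. -/
noncomputable abbrev resBimod (f : A →ₐ[k] B) : Bimod k B ⥤ Bimod k A := restrictBimod f f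

/-- The twist `M ↦ M_σ`: the left action is that of `M`, the right action is `m · b = m σ(b)`. -/
noncomputable abbrev twist (σ : B ≃ₐ[k] B) : Bimod k B ⥤ Bimod k B :=
  restrictBimod (AlgHom.id k B) σ.toAlgHom

end Restriction

section Normal

variable {A : Type v} [Ring A]

/-- `x` is normal: `Ax = xA`. -/
def IsNormalElement (x : A) : Prop :=
  (Set.range fun a : A => a * x) = Set.range fun a : A => x * a

/-- The quotient `A/(x)` of `A` by the two-sided ideal generated by `x`. -/
abbrev NormalQuotient (x : A) : Type v := (TwoSidedIdeal.span {x}).ringCon.Quotient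

variable {k : Type u} [Field k] [Algebra k A]

/-- The projection `A → A/(x)`. -/
def proj (k : Type u) [Field k] [Algebra k A] (x : A) : A →ₐ[k] NormalQuotient x :=
  (TwoSidedIdeal.span {x}).ringCon.mkₐ (α := k)

theorem alpha_self {x : A} (hx : IsRegular x) {α : A ≃ₐ[k] A}
    (hα : ∀ a, a * x = x * α a) : α x = x :=
  (hx.left (hα x)).symm

theorem mem_span_alpha_iff {x : A} {α : A ≃ₐ[k] A} (h : α x = x) (a : A) :
    α a ∈ TwoSidedIdeal.span {x} ↔ a ∈ TwoSidedIdeal.span {x} := by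
  have key : ∀ (β : A ≃ₐ[k] A), β x = x → ∀ b ∈ TwoSidedIdeal.span {x},
      β b ∈ TwoSidedIdeal.span {x} := by
    intro β hβ b hb
    have hle : TwoSidedIdeal.span {x} ≤ (TwoSidedIdeal.span {x}).comap (β : A →+* A) := by
      rw [TwoSidedIdeal.span_le]
      rintro y rfl
      change y ∈ TwoSidedIdeal.comap _ _
      rw [TwoSidedIdeal.mem_comap]
      change β y ∈ _
      rw [hβ]
      exact TwoSidedIdeal.subset_span rfl
    exact (TwoSidedIdeal.mem_comap (β : A →+* A)).1 (hle hb)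
  refine ⟨fun ha => ?_, key α h a⟩
  have := key α.symm (by rw [AlgEquiv.symm_apply_eq, h]) _ ha
  simpa using this

/-- The automorphism of `A/(x)` induced by the automorphism `α` of `A` with `a x = x α(a)`. -/
def inducedAut (x : A) (hx : IsRegular x) (α : A ≃ₐ[k] A) (hα : ∀ a, a * x = x * α a) :
    NormalQuotient x ≃ₐ[k] NormalQuotient x :=
  RingCon.congrₐ k α (by
    ext a b
    rw [RingCon.comap_rel, TwoSidedIdeal.rel_iff, TwoSidedIdeal.rel_iff, ← map_sub]
    exact (mem_span_alpha_iff (alpha_self hx hα) (a - b)).symm)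

theorem inducedAut_proj (x : A) (hx : IsRegular x) (α : A ≃ₐ[k] A)
    (hα : ∀ a, a * x = x * α a) (a : A) :
    inducedAut x hx α hα (proj k x a) = proj k x (α a) :=
  rfl

end Normal

end HochschildNormal

/-!
Write `Aᵉ = A ⊗ Aᵒᵖ`, `B = A/(x)`, and let `Ω` be the kernel of the multiplication `Aᵉ → A`, a
projective bimodule because `A` has projective dimension at most one. Reduce the exact sequence
`0 → Ω → Aᵉ → A → 0` modulo `x` on both sides, that is, apply `Bᵉ ⊗_{Aᵉ} -`. The result is right
exact, the reductions `Q₁` of `Ω` and `Q₀` of `Aᵉ` are projective `B`-bimodules, and the kernel of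
`Q₁ → Q₀` is again a copy of `B`, spanned by the class of `dx = 1 ⊗ x - x ⊗ 1`. Since
`c · dx ≡ dx · α(c)` modulo `xΩ + Ωx`, this copy of `B` has its right action twisted by `α`.
So there is an exact sequence `0 → B_tw → Q₁ → Q₀ → B → 0` with `Q₀`, `Q₁` projective.

The same holds with `Aᵉ → Bᵉ` composed with a power `αᵖ` on the right factor
(`exists_twisted_resolution`): writing `X_p` for the reduction of `A` along this map, there are
exact sequences `0 → X_{p+1} → Q₁ → Q₀ → X_p → 0`, with `X_0 = B`. Regularity of `x` enters in
`IsEnvelopingRing.exists_reduction_exact`, once on each side: on one side to compare the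
augmentations of the two parts of an element of `xAᵉ + Aᵉx` that lies in `Ω`, on the other side for
the independence statement `exists_eq_of_mul_eq_mul`, which rests on flatness over the field `k`.

Splicing these sequences gives `Hⁿ⁺²ᵖ(B, M) ≅ Extⁿ(X_p, M)` for `n ≥ 1` (`exists_extFunctor_shift`).
By the adjunction between reduction and restriction of scalars, `Hom(Q₁, M)`, `Hom(Q₀, M)` and
`Hom(X_{p+1}, M)` are `Hom(Ω, M_{αᵖ})`, `Hom(Aᵉ, M_{αᵖ})` and `H⁰(A, M_{αᵖ⁺¹})`. As `H¹(A, M_{αᵖ})`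
is the cokernel of `Hom(Aᵉ, M_{αᵖ}) → Hom(Ω, M_{αᵖ})`, applying `Hom(-, M)` to the `p`-th sequence
yields the four-term sequence (`exists_fourTermSequence`). Every map is a precomposition with a
fixed class, or is determined by such maps, hence is natural in `M`.
-/

/-! ### Ext functors and their long exact sequences -/

namespace HochschildNormal

section Ext

open Abelian

universe w t v₁ u₁ v₂ u₂

variable (k : Type t) [CommRing k]

section Functor

variable {C : Type u₁} [Category.{v₁} C] [Abelian C] [Linear k C] [HasExt.{w} C]

/-- `Extⁿ(X, -)` as a functor with values in `k`-modules; `hochschild k A n` is the case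
`X = A`. -/
noncomputable def extFunctor (X : C) (n : ℕ) : C ⥤ ModuleCat.{w} k where
  obj Y := ModuleCat.of k (Ext X Y n)
  map φ := ModuleCat.ofHom ((Ext.mk₀ φ).postcompOfLinear k X (add_zero n))
  map_id M := by
    ext y
    simp [Ext.postcompOfLinear]
  map_comp φ ψ := by
    ext y
    simp [Ext.postcompOfLinear]

/-- Precomposition with a class `ω ∈ Extᵐ(X, Y)`, as a natural transformation
`Extⁿ(Y, -) ⟶ Extᵐ⁺ⁿ(X, -)`. -/
noncomputable def extPrecomp {X Y : C} {m : ℕ} (ω : Ext X Y m) {n n' : ℕ} (h : m + n = n') :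
    extFunctor k Y n ⟶ extFunctor k X n' where
  app Z := ModuleCat.ofHom (ω.precompOfLinear k Z h)
  naturality Z Z' φ := by
    ext y
    exact (Ext.comp_assoc_of_third_deg_zero ω y (Ext.mk₀ φ) h).symm

theorem extPrecomp_g_injective {S : ShortComplex C} (hS : S.ShortExact) (Z : C) :
    Function.Injective ((extPrecomp k (Ext.mk₀ S.g) (zero_add 0)).app Z) := by
  have := hS.epi_g
  rw [injective_iff_map_eq_zero]
  intro (y : Ext S.X₃ Z 0) (hy : (Ext.mk₀ S.g).comp y (zero_add 0) = 0)
  obtain ⟨y, rfl⟩ := (Ext.mk₀_bijective _ _).2 y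
  rw [Ext.mk₀_comp_mk₀, Ext.mk₀_eq_zero_iff] at hy
  refine (Ext.mk₀_eq_zero_iff y).2 ?_
  rw [← cancel_epi S.g, hy, Limits.comp_zero]

theorem extPrecomp_g_f_exact {S : ShortComplex C} (hS : S.ShortExact) (n : ℕ) (Z : C) :
    Function.Exact ((extPrecomp k (Ext.mk₀ S.g) (zero_add n)).app Z)
      ((extPrecomp k (Ext.mk₀ S.f) (zero_add n)).app Z) := by
  intro (y : Ext S.X₂ Z n)
  refine ⟨fun h => Ext.contravariant_sequence_exact₂ hS Z y h, ?_⟩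
  rintro ⟨(z : Ext S.X₃ Z n), rfl⟩
  change (Ext.mk₀ S.f).comp ((Ext.mk₀ S.g).comp z (zero_add n)) (zero_add n) = 0
  simp only [Ext.mk₀_comp_mk₀_assoc, ShortComplex.zero, Ext.mk₀_zero, Ext.zero_comp]

theorem extPrecomp_f_extClass_exact {S : ShortComplex C} (hS : S.ShortExact) {n n' : ℕ}
    (h : 1 + n = n') (Z : C) :
    Function.Exact ((extPrecomp k (Ext.mk₀ S.f) (zero_add n)).app Z)
      ((extPrecomp k hS.extClass h).app Z) := by
  intro (y : Ext S.X₁ Z n)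
  refine ⟨fun hy => Ext.contravariant_sequence_exact₁ hS Z y h hy, ?_⟩
  rintro ⟨(z : Ext S.X₂ Z n), rfl⟩
  change hS.extClass.comp ((Ext.mk₀ S.f).comp z (zero_add n)) h = 0
  simp only [ShortComplex.ShortExact.extClass_comp_assoc]

/-- If the middle term is projective, the connecting map into positive degree is surjective. -/
theorem extPrecomp_extClass_surjective {S : ShortComplex C} (hS : S.ShortExact)
    [Projective S.X₂] {n n' : ℕ} (h : 1 + n = n') (Z : C) :
    Function.Surjective ((extPrecomp k hS.extClass h).app Z) := fun (y : Ext S.X₃ Z n') =>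
  Ext.contravariant_sequence_exact₃ hS Z y
    (Ext.eq_zero_of_hasProjectiveDimensionLT _ 1 (by lia)) h

/-- If the middle term is projective, the connecting map out of positive degree is injective. -/
theorem extPrecomp_extClass_injective {S : ShortComplex C} (hS : S.ShortExact)
    [Projective S.X₂] {n n' : ℕ} (hn : 1 ≤ n) (h : 1 + n = n') (Z : C) :
    Function.Injective ((extPrecomp k hS.extClass h).app Z) := by
  rw [injective_iff_map_eq_zero]
  intro y hy
  obtain ⟨(z : Ext S.X₂ Z n), rfl⟩ := (extPrecomp_f_extClass_exact k hS h Z y).1 hy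
  rw [Ext.eq_zero_of_hasProjectiveDimensionLT z 1 hn]
  exact map_zero ((extPrecomp k (Ext.mk₀ S.f) (zero_add n)).app Z).hom

end Functor

section NatTrans

variable {k} {C : Type u₁} [Category.{v₁} C] {U V W : C ⥤ ModuleCat.{w} k}

/-- A natural transformation which vanishes on the kernel of a pointwise surjective one factors
through it. -/
theorem exists_natTrans_factor (v : U ⟶ V) (t : U ⟶ W)
    (hv : ∀ M, Function.Surjective (v.app M)) (h : ∀ M x, v.app M x = 0 → t.app M x = 0) :
    ∃ f : V ⟶ W, ∀ M x, f.app M (v.app M x) = t.app M x := by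
  let F (M : C) : V.obj M →ₗ[k] W.obj M :=
    (LinearMap.ker (v.app M).hom).liftQ (t.app M).hom (fun x hx => h M x hx) ∘ₗ
      ((v.app M).hom.quotKerEquivOfSurjective
        (hv M)).symm.toLinearMap
  have hF (M : C) (x : U.obj M) : F M (v.app M x) = t.app M x := by
    have : ((v.app M).hom.quotKerEquivOfSurjective
        (hv M)).symm (v.app M x) = Submodule.Quotient.mk x := by
      rw [LinearEquiv.symm_apply_eq]
      rfl
    simp only [F, LinearMap.comp_apply, LinearEquiv.coe_coe, this]
    rfl
  refine ⟨{ app := fun M => ModuleCat.ofHom (F M), naturality := fun M N φ => ?_ }, hF⟩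
  ext y
  obtain ⟨x, rfl⟩ := hv M y
  have h₁ := ConcreteCategory.congr_hom (v.naturality φ) x
  have h₂ := ConcreteCategory.congr_hom (t.naturality φ) x
  simp only [ConcreteCategory.comp_apply] at h₁ h₂ ⊢
  change F N _ = W.map φ (F M _)
  rw [← h₁, hF, hF, h₂]

/-- A pointwise bijective natural transformation has an inverse. -/
theorem exists_natTrans_inverse (v : U ⟶ V) (hv : ∀ M, Function.Bijective (v.app M)) :
    ∃ f : V ⟶ U, ∀ M, Function.LeftInverse (f.app M) (v.app M) ∧
      Function.RightInverse (f.app M) (v.app M) := by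
  obtain ⟨f, hf⟩ := exists_natTrans_factor v (𝟙 U) (fun M => (hv M).2) fun M x hx =>
    (hv M).1 (hx.trans (map_zero (v.app M).hom).symm)
  refine ⟨f, fun M => ⟨hf M, fun y => ?_⟩⟩
  obtain ⟨x, rfl⟩ := (hv M).2 y
  exact congrArg _ (hf M x)

end NatTrans

/-! ### The four-term sequence of a partial adjunction -/

section FourTerm

variable {k}

/-- `η : N ⟶ G Q` is a universal arrow from `N` to `G`: the object `Q` is the value at `N` of a
partially defined left adjoint of `G`. -/
def IsUniversalArrow {C : Type u₁} [Category.{v₁} C] {D : Type u₂} [Category.{v₂} D]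
    (G : C ⥤ D) {N : D} {Q : C} (η : N ⟶ G.obj Q) : Prop :=
  ∀ M : C, Function.Bijective fun f : Q ⟶ M => η ≫ G.map f

/-- A left adjoint preserves projectives if its right adjoint preserves epimorphisms; only the
universal arrow at the projective object matters. -/
theorem IsUniversalArrow.projective {C : Type u₁} [Category.{v₁} C] {D : Type u₂}
    [Category.{v₂} D] {G : C ⥤ D} [G.PreservesEpimorphisms] {N : D} {Q : C}
    {η : N ⟶ G.obj Q} (hη : IsUniversalArrow G η) [Projective N] : Projective Q where
  factors {E M} f e _ := by
    obtain ⟨l, hl⟩ := (hη E).2 (Projective.factorThru (η ≫ G.map f) (G.map e))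
    refine ⟨l, (hη M).1 ?_⟩
    simp only at hl ⊢
    rw [G.map_comp, ← Category.assoc, hl, Projective.factorThru_comp]

variable {C : Type u₁} [Category.{v₁} C] [Abelian C] [Linear k C] [HasExt.{w} C]
  {D : Type u₂} [Category.{v₂} D] [Abelian D] [Linear k D] [HasExt.{w} D]

variable (k) in
/-- The map `Hom(Q, M) → Hom(N, G M)` attached to an arrow `N ⟶ G Q`, in terms of `Ext⁰`. -/
noncomputable def extUnit {G : C ⥤ D} [G.Additive] [G.Linear k] {N : D} {Q : C}
    (η : N ⟶ G.obj Q) : extFunctor k Q 0 ⟶ G ⋙ extFunctor k N 0 where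
  app M := ModuleCat.ofHom <|
    (Ext.linearEquiv₀ (R := k)).symm.toLinearMap ∘ₗ Linear.leftComp k (G.obj M) η ∘ₗ
      G.mapLinearMap k ∘ₗ (Ext.linearEquiv₀ (R := k)).toLinearMap
  naturality M M' φ := by
    ext y
    obtain ⟨y, rfl⟩ := (Ext.mk₀_bijective Q M).2 y
    have h (M : C) (f : Q ⟶ M) : (Ext.linearEquiv₀ (R := k)) (Ext.mk₀ f) = f :=
      Ext.linearEquiv₀.right_inv f
    change Ext.mk₀ (η ≫ G.map (Ext.linearEquiv₀ (R := k)
      ((Ext.mk₀ y).comp (Ext.mk₀ φ) (add_zero 0)))) =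
      (Ext.mk₀ (η ≫ G.map (Ext.linearEquiv₀ (R := k) (Ext.mk₀ y)))).comp
        (Ext.mk₀ (G.map φ)) (add_zero 0)
    rw [Ext.mk₀_comp_mk₀, Ext.mk₀_comp_mk₀, h, h, G.map_comp, Category.assoc]

theorem extUnit_app_mk₀ {G : C ⥤ D} [G.Additive] [G.Linear k] {N : D} {Q : C}
    (η : N ⟶ G.obj Q) {M : C} (f : Q ⟶ M) :
    (extUnit k η).app M (Ext.mk₀ f) = Ext.mk₀ (η ≫ G.map f) :=
  congrArg (fun l : Q ⟶ M => Ext.mk₀ (η ≫ G.map l)) ((Ext.linearEquiv₀ (R := k)).right_inv f)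

theorem IsUniversalArrow.extUnit_bijective {G : C ⥤ D} [G.Additive] [G.Linear k] {N : D} {Q : C}
    {η : N ⟶ G.obj Q} (hη : IsUniversalArrow G η) (M : C) :
    Function.Bijective ((extUnit k η).app M) := by
  constructor
  · intro y y' h
    obtain ⟨f, rfl⟩ := (Ext.mk₀_bijective Q M).2 y
    obtain ⟨f', rfl⟩ := (Ext.mk₀_bijective Q M).2 y'
    rw [extUnit_app_mk₀, extUnit_app_mk₀] at h
    exact congrArg _ ((hη M).1 ((Ext.mk₀_bijective N (G.obj M)).1 h))
  · intro z
    obtain ⟨l, rfl⟩ := (Ext.mk₀_bijective N (G.obj M)).2 z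
    obtain ⟨f, rfl⟩ := (hη M).2 l
    exact ⟨Ext.mk₀ f, extUnit_app_mk₀ η f⟩

/-- Compatibility of `extUnit` with a commutative square of arrows. -/
theorem extUnit_comp_extPrecomp {G : C ⥤ D} [G.Additive] [G.Linear k] {N N' : D} {Q Q' : C}
    {η : N ⟶ G.obj Q} {η' : N' ⟶ G.obj Q'} {f : N ⟶ N'} {d : Q ⟶ Q'}
    (h : f ≫ η' = η ≫ G.map d) (M : C) (y : Ext Q' M 0) :
    (extPrecomp k (Ext.mk₀ f) (zero_add 0)).app (G.obj M) ((extUnit k η').app M y) =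
      (extUnit k η).app M ((extPrecomp k (Ext.mk₀ d) (zero_add 0)).app M y) := by
  obtain ⟨y, rfl⟩ := (Ext.mk₀_bijective Q' M).2 y
  rw [extUnit_app_mk₀]
  change (Ext.mk₀ f).comp (Ext.mk₀ (η' ≫ G.map y)) (zero_add 0) =
    (extUnit k η).app M ((Ext.mk₀ d).comp (Ext.mk₀ y) (zero_add 0))
  rw [Ext.mk₀_comp_mk₀, Ext.mk₀_comp_mk₀]
  refine Eq.trans ?_ (extUnit_app_mk₀ η (d ≫ y)).symm
  rw [G.map_comp, ← Category.assoc, h, Category.assoc]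

/-- Let `0 → Ω → P → N → 0` be exact in `D` with `P` projective, and let
`0 → X' → Q₁ → Q₀ → X → 0` be exact in `C`, with image `K` in the middle, where `Q₀` and `Q₁` are
projective. If `Q₁`, `Q₀` are the values at `Ω`, `P` of a partial left adjoint of `G`, and `X'`
is the value at `N` of a partial left adjoint of `G'`, then there is a natural exact sequence
`0 → Ext¹(X, M) → Ext¹(N, G M) → Hom(N, G' M) → Ext²(X, M) → 0`. -/
theorem exists_fourTermSequence {G G' : C ⥤ D} [G.Additive] [G.Linear k] [G'.Additive]
    [G'.Linear k] {S : ShortComplex D} (hS : S.ShortExact) [Projective S.X₂]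
    {X X' Q₀ Q₁ K : C} [Projective Q₀] [Projective Q₁]
    {a : X' ⟶ Q₁} {b : Q₁ ⟶ K} {i : K ⟶ Q₀} {c : Q₀ ⟶ X} {hab : a ≫ b = 0} {hic : i ≫ c = 0}
    (h₂ : (ShortComplex.mk a b hab).ShortExact) (h₁ : (ShortComplex.mk i c hic).ShortExact)
    {ηΩ : S.X₁ ⟶ G.obj Q₁} {ηP : S.X₂ ⟶ G.obj Q₀} {ηN : S.X₃ ⟶ G'.obj X'}
    (hΩ : IsUniversalArrow G ηΩ) (hP : IsUniversalArrow G ηP) (hN : IsUniversalArrow G' ηN)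
    (comm : S.f ≫ ηP = ηΩ ≫ G.map (b ≫ i)) :
    ∃ (f : extFunctor k X 1 ⟶ G ⋙ extFunctor k S.X₃ 1)
      (e : G ⋙ extFunctor k S.X₃ 1 ⟶ G' ⋙ extFunctor k S.X₃ 0)
      (g : G' ⋙ extFunctor k S.X₃ 0 ⟶ extFunctor k X 2),
      ∀ M : C, Function.Injective (f.app M) ∧ Function.Exact (f.app M) (e.app M) ∧
        Function.Exact (e.app M) (g.app M) ∧ Function.Surjective (g.app M) := by
  have : Projective (ShortComplex.mk i c hic).X₂ := ‹Projective Q₀›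
  have : Projective (ShortComplex.mk a b hab).X₂ := ‹Projective Q₁›
  -- `u` presents `Ext¹(N, G M)` as a quotient of `Hom(Q₁, M) = Hom(Ω, G M)`, and `v` presents
  -- `Ext¹(X, M)` as a quotient of `Hom(K, M)`; both are quotients by the image of `Hom(Q₀, M)`.
  let u : extFunctor k Q₁ 0 ⟶ G ⋙ extFunctor k S.X₃ 1 :=
    extUnit k ηΩ ≫ Functor.whiskerLeft G (extPrecomp k hS.extClass (add_zero 1))
  let v : extFunctor k K 0 ⟶ extFunctor k X 1 := extPrecomp k h₁.extClass (add_zero 1)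
  let j : extFunctor k K 0 ⟶ extFunctor k Q₁ 0 := extPrecomp k (Ext.mk₀ b) (zero_add 0)
  let r : extFunctor k Q₀ 0 ⟶ extFunctor k K 0 := extPrecomp k (Ext.mk₀ i) (zero_add 0)
  let s : extFunctor k Q₁ 0 ⟶ extFunctor k X' 0 := extPrecomp k (Ext.mk₀ a) (zero_add 0)
  have hu (M) : Function.Surjective (u.app M) :=
    (extPrecomp_extClass_surjective k hS (add_zero 1) (G.obj M)).comp (hΩ.extUnit_bijective M).2
  have hv (M) : Function.Surjective (v.app M) :=
    extPrecomp_extClass_surjective k h₁ (add_zero 1) M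
  have hj (M) : Function.Injective (j.app M) := extPrecomp_g_injective k h₂ M
  have hrv (M) : Function.Exact (r.app M) (v.app M) :=
    extPrecomp_f_extClass_exact k h₁ (add_zero 1) M
  have hjs (M) : Function.Exact (j.app M) (s.app M) := extPrecomp_g_f_exact k h₂ 0 M
  have hru (M) (z) : u.app M z = 0 ↔ ∃ y, j.app M (r.app M y) = z := by
    have hjr (y : Ext Q₀ M 0) : j.app M (r.app M y) =
        (extPrecomp k (Ext.mk₀ (b ≫ i)) (zero_add 0)).app M y := by
      change (Ext.mk₀ b).comp ((Ext.mk₀ i).comp y (zero_add 0)) (zero_add 0) =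
        (Ext.mk₀ (b ≫ i)).comp y (zero_add 0)
      exact Ext.mk₀_comp_mk₀_assoc b i y
    refine (extPrecomp_f_extClass_exact k hS (add_zero 1) (G.obj M) _).trans ?_
    constructor
    · rintro ⟨t, ht⟩
      obtain ⟨y, rfl⟩ := (hP.extUnit_bijective (k := k) M).2 t
      refine ⟨y, (hΩ.extUnit_bijective (k := k) M).1 ?_⟩
      exact (congrArg _ (hjr y)).trans ((extUnit_comp_extPrecomp comm M y).symm.trans ht)
    · rintro ⟨y, rfl⟩
      refine ⟨(extUnit k ηP).app M y, ?_⟩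
      exact (extUnit_comp_extPrecomp comm M y).trans (congrArg _ (hjr y)).symm
  obtain ⟨f, hf⟩ := exists_natTrans_factor v (j ≫ u) hv fun M x hx => by
    obtain ⟨y, rfl⟩ := (hrv M x).1 hx
    exact (hru M _).2 ⟨y, rfl⟩
  obtain ⟨e, he⟩ := exists_natTrans_factor u (s ≫ extUnit k ηN) hu fun M x hx => by
    obtain ⟨y, rfl⟩ := (hru M x).1 hx
    change (extUnit k ηN).app M (s.app M (j.app M (r.app M y))) = 0
    rw [(hjs M _).2 ⟨_, rfl⟩]
    exact map_zero ((extUnit k ηN).app M).hom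
  obtain ⟨n, hn⟩ := exists_natTrans_inverse (extUnit k ηN) (hN.extUnit_bijective (k := k))
  let q₁ : extFunctor k K 1 ⟶ extFunctor k X 2 := extPrecomp k h₁.extClass rfl
  let q₂ : extFunctor k X' 0 ⟶ extFunctor k K 1 := extPrecomp k h₂.extClass rfl
  have hq₁ (M) : Function.Bijective (q₁.app M) :=
    ⟨extPrecomp_extClass_injective k h₁ le_rfl rfl M, extPrecomp_extClass_surjective k h₁ rfl M⟩
  have hq₂ (M) : Function.Surjective (q₂.app M) := extPrecomp_extClass_surjective k h₂ rfl M
  have hsq (M) : Function.Exact (s.app M) (q₂.app M) := extPrecomp_f_extClass_exact k h₂ rfl M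
  refine ⟨f, e, n ≫ q₂ ≫ q₁, fun M => ⟨?_, ?_, ?_, ?_⟩⟩
  · refine (injective_iff_map_eq_zero (f.app M).hom).2 fun x hx => ?_
    obtain ⟨x, rfl⟩ := hv M x
    obtain ⟨y, hy⟩ := (hru M (j.app M x)).1 ((hf M x).symm.trans hx)
    exact (hrv M x).2 ⟨y, hj M hy⟩
  · intro z
    obtain ⟨z, rfl⟩ := hu M z
    rw [he]
    have h0 : (s ≫ extUnit k ηN).app M z = 0 ↔ s.app M z = 0 :=
      map_eq_zero_iff ((extUnit k ηN).app M).hom (hN.extUnit_bijective M).1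
    rw [h0, hjs M z]
    constructor
    · rintro ⟨x, rfl⟩
      exact ⟨v.app M x, hf M x⟩
    · rintro ⟨x, hx⟩
      obtain ⟨x, rfl⟩ := hv M x
      have h1 : u.app M (j.app M x - z) = 0 := by
        refine (map_sub (u.app M).hom (j.app M x) z).trans (sub_eq_zero.2 ?_)
        exact (hf M x).symm.trans hx
      obtain ⟨y, hy⟩ := (hru M _).1 h1
      refine ⟨x - r.app M y, ?_⟩
      refine (map_sub (j.app M).hom x (r.app M y)).trans ?_
      exact (congrArg (fun w => j.app M x - w) hy).trans (sub_sub_cancel _ _)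
  · intro t
    obtain ⟨t, rfl⟩ := (hN.extUnit_bijective (k := k) M).2 t
    have h0 : (n ≫ q₂ ≫ q₁).app M ((extUnit k ηN).app M t) = q₁.app M (q₂.app M t) :=
      congrArg (fun w => q₁.app M (q₂.app M w)) ((hn M).1 t)
    have h1 : q₁.app M (q₂.app M t) = 0 ↔ q₂.app M t = 0 :=
      map_eq_zero_iff (q₁.app M).hom (hq₁ M).1
    rw [h0, h1, hsq M t]
    constructor
    · rintro ⟨z, rfl⟩
      exact ⟨u.app M z, he M z⟩
    · rintro ⟨z, hz⟩
      obtain ⟨z, rfl⟩ := hu M z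
      exact ⟨z, (hN.extUnit_bijective (k := k) M).1 ((he M z).symm.trans hz)⟩
  · exact ((hq₁ M).2.comp (hq₂ M)).comp fun t => ⟨_, (hn M).1 t⟩

/-- Dimension shift along an exact sequence `0 → X' → Q₁ → Q₀ → X → 0` with `Q₀`, `Q₁`
projective: `Extⁿ⁺²(X, -) ≅ Extⁿ(X', -)` for `n ≥ 1`. -/
theorem exists_extFunctor_shift
    {X X' Q₀ Q₁ K : C} [Projective Q₀] [Projective Q₁]
    {a : X' ⟶ Q₁} {b : Q₁ ⟶ K} {i : K ⟶ Q₀} {c : Q₀ ⟶ X} {hab : a ≫ b = 0} {hic : i ≫ c = 0}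
    (h₂ : (ShortComplex.mk a b hab).ShortExact) (h₁ : (ShortComplex.mk i c hic).ShortExact)
    {n : ℕ} (hn : 1 ≤ n) :
    ∃ q : extFunctor k X' n ⟶ extFunctor k X (n + 2), ∀ M, Function.Bijective (q.app M) := by
  have : Projective (ShortComplex.mk i c hic).X₂ := ‹Projective Q₀›
  have : Projective (ShortComplex.mk a b hab).X₂ := ‹Projective Q₁›
  refine ⟨extPrecomp k h₂.extClass (add_comm 1 n) ≫
    extPrecomp k h₁.extClass (add_comm 1 (n + 1)), fun M => ?_⟩
  refine Function.Bijective.comp (g := (extPrecomp k h₁.extClass (add_comm 1 (n + 1))).app M)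
    (f := (extPrecomp k h₂.extClass (add_comm 1 n)).app M) ?_ ?_
  · exact ⟨extPrecomp_extClass_injective k h₁ (by lia) _ M,
      extPrecomp_extClass_surjective k h₁ _ M⟩
  · exact ⟨extPrecomp_extClass_injective k h₂ hn _ M, extPrecomp_extClass_surjective k h₂ _ M⟩

end FourTerm

end Ext

/-! ### Reduction along a surjective ring homomorphism -/

section Reduction

/-- A semilinear map `q : N → Q` over `φ : R → S` is a reduction if it is surjective with kernel
`(ker φ) N`. When `φ` is surjective, this says that `q` exhibits `Q` as `S ⊗_R N`. -/
structure IsReduction {R S : Type v} [Semiring R] [Semiring S] {φ : R →+* S} {N Q : Type v}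
    [AddCommMonoid N] [Module R N] [AddCommMonoid Q] [Module S Q] (q : N →ₛₗ[φ] Q) : Prop where
  surjective : Function.Surjective q
  mem_of_eq_zero : ∀ n, q n = 0 → n ∈ RingHom.ker φ • (⊤ : Submodule R N)

variable {R S : Type v} [Semiring R] [Semiring S] {φ : R →+* S}

theorem semilinear_eq_zero_of_mem_ker_smul {N M : Type v} [AddCommGroup N] [Module R N]
    [AddCommGroup M] [Module S M] (f : N →ₛₗ[φ] M) {n : N}
    (hn : n ∈ RingHom.ker φ • (⊤ : Submodule R N)) : f n = 0 := by
  induction hn using Submodule.smul_induction_on' with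
  | smul r hr n _ => rw [map_smulₛₗ, (RingHom.mem_ker).1 hr, zero_smul]
  | add m _ n _ hm hn => rw [map_add, hm, hn, add_zero]

theorem IsReduction.eq_zero_iff {N Q : Type v} [AddCommGroup N] [Module R N] [AddCommGroup Q]
    [Module S Q] {q : N →ₛₗ[φ] Q} (hq : IsReduction q) (n : N) :
    q n = 0 ↔ n ∈ RingHom.ker φ • (⊤ : Submodule R N) :=
  ⟨hq.mem_of_eq_zero n, semilinear_eq_zero_of_mem_ker_smul q⟩

/-- Semilinear maps out of `N` factor through a reduction of `N`. -/
theorem IsReduction.exists_lift (hφ : Function.Surjective φ) {N Q M : Type v} [AddCommGroup N]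
    [Module R N] [AddCommGroup Q] [Module S Q] [AddCommGroup M] [Module S M] {q : N →ₛₗ[φ] Q}
    (hq : IsReduction q) (f : N →ₛₗ[φ] M) : ∃ g : Q →ₗ[S] M, ∀ n, g (q n) = f n := by
  let s := Function.surjInv hq.surjective
  have hs (y : Q) : q (s y) = y := Function.surjInv_eq hq.surjective y
  have hf (n n' : N) (h : q n = q n') : f n = f n' := by
    rw [← sub_eq_zero, ← map_sub]
    exact semilinear_eq_zero_of_mem_ker_smul f
      (hq.mem_of_eq_zero _ (by rw [map_sub, h, sub_self]))
  refine ⟨{ toFun := fun y => f (s y), map_add' := fun y y' => ?_, map_smul' := fun c y => ?_ },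
    fun n => hf _ _ (hs _)⟩
  · rw [← map_add]
    exact hf _ _ (by rw [map_add, hs, hs, hs])
  · obtain ⟨r, rfl⟩ := hφ c
    rw [RingHom.id_apply, ← map_smulₛₗ f]
    exact hf _ _ (by rw [map_smulₛₗ, hs, hs])

/-- Reductions exist: `S = R / ker φ` acts on `N / (ker φ) N`. -/
theorem exists_isReduction {R S : Type v} [Ring R] [Ring S] {φ : R →+* S} (hφ : Function.Surjective φ) (N : Type v) [AddCommGroup N]
    [Module R N] : ∃ (Q : ModuleCat.{v} S) (q : N →ₛₗ[φ] Q), IsReduction q := by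
  let I : Submodule R N := RingHom.ker φ • ⊤
  have hker : RingHom.ker φ ≤ RingHom.ker (Module.toAddMonoidEnd R (N ⧸ I)) := fun r hr => by
    rw [RingHom.mem_ker]
    ext m
    obtain ⟨n, rfl⟩ := I.mkQ_surjective m
    exact (Submodule.Quotient.mk_eq_zero I).2 (Submodule.smul_mem_smul hr trivial)
  let ψ : S →+* AddMonoid.End (N ⧸ I) :=
    φ.liftOfRightInverse _ (Function.surjInv_eq hφ) ⟨Module.toAddMonoidEnd R (N ⧸ I), hker⟩
  have hψ (r : R) : ψ (φ r) = Module.toAddMonoidEnd R (N ⧸ I) r :=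
    φ.liftOfRightInverse_comp_apply _ (Function.surjInv_eq hφ) ⟨_, hker⟩ r
  let : Module S (N ⧸ I) := Module.compHom _ ψ
  refine ⟨ModuleCat.of S (N ⧸ I),
    { toFun := fun n => I.mkQ n
      map_add' := map_add I.mkQ
      map_smul' := fun r n => ?_ }, I.mkQ_surjective, fun n hn => ?_⟩
  · exact (DFunLike.congr_fun (hψ r) (I.mkQ n)).symm
  · exact (Submodule.Quotient.mk_eq_zero I).1 hn

end Reduction

/-! ### Kernels of tensor products of quotient maps -/

section Enveloping

open MulOpposite

variable {k : Type u} [Field k] {A : Type v} [Ring A] [Algebra k A]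

theorem proj_surjective (x : A) : Function.Surjective (proj k x) := fun b =>
  RingCon.mk'_surjective _ b

/-- For a normal element `x` the two-sided ideal `(x)` is the right ideal `xA`. -/
theorem proj_eq_zero_iff {x : A} {α : A ≃ₐ[k] A} (hα : ∀ a, a * x = x * α a) (a : A) :
    proj k x a = 0 ↔ ∃ b, a = x * b := by
  have h0 : proj k x a = 0 ↔ a ∈ TwoSidedIdeal.span {x} := by
    rw [TwoSidedIdeal.mem_iff]
    exact RingCon.eq _
  rw [h0]
  constructor
  · intro h
    have hle : TwoSidedIdeal.span {x} ≤ TwoSidedIdeal.mk' {a | ∃ b, a = x * b}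
        ⟨0, by simp⟩ (by rintro _ _ ⟨b, rfl⟩ ⟨c, rfl⟩; exact ⟨b + c, by rw [mul_add]⟩)
        (by rintro _ ⟨b, rfl⟩; exact ⟨-b, by rw [mul_neg]⟩)
        (by rintro a _ ⟨b, rfl⟩; exact ⟨α a * b, by rw [← mul_assoc, hα, mul_assoc]⟩)
        (by rintro _ a ⟨b, rfl⟩; exact ⟨b * a, by rw [mul_assoc]⟩) := by
      rw [TwoSidedIdeal.span_le]
      rintro y rfl
      simpa using ⟨1, (mul_one y).symm⟩
    simpa using hle h
  · rintro ⟨b, rfl⟩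
    exact TwoSidedIdeal.mul_mem_right _ _ _ (TwoSidedIdeal.subset_span rfl)

theorem rTensor_mulLeft_apply {U V : Type*} [Ring U] [Algebra k U] [Ring V] [Algebra k V] (x : U)
    (r : U ⊗[k] V) : (LinearMap.mulLeft k x).rTensor V r = (x ⊗ₜ 1) * r := by
  induction r with
  | zero => simp
  | tmul a b => simp
  | add r s hr hs => rw [map_add, hr, hs, mul_add]

theorem lTensor_mulLeft_apply {U V : Type*} [Ring U] [Algebra k U] [Ring V] [Algebra k V] (y : V)
    (r : U ⊗[k] V) : (LinearMap.mulLeft k y).lTensor U r = (1 ⊗ₜ y) * r := by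
  induction r with
  | zero => simp
  | tmul a b => simp
  | add r s hr hs => rw [map_add, hr, hs, mul_add]

/-- The kernel of `f ⊗ g`, when the kernels of `f` and `g` are principal right ideals. -/
theorem exists_eq_of_map_eq_zero {U V U' V' : Type*} [Ring U] [Algebra k U] [Ring V] [Algebra k V]
    [Ring U'] [Algebra k U'] [Ring V'] [Algebra k V'] {f : U →ₐ[k] U'} {g : V →ₐ[k] V'}
    (hf : Function.Surjective f) (hg : Function.Surjective g) {x : U} {y : V}
    (hx : ∀ a, f a = 0 ↔ ∃ b, a = x * b) (hy : ∀ a, g a = 0 ↔ ∃ b, a = y * b)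
    {r : U ⊗[k] V} (hr : Algebra.TensorProduct.map f g r = 0) :
    ∃ r₁ r₂, r = (x ⊗ₜ 1) * r₁ + (1 ⊗ₜ y) * r₂ := by
  have hxe : Function.Exact (LinearMap.mulLeft k x) f.toLinearMap := fun a => by
    simp [hx, eq_comm]
  have hye : Function.Exact (LinearMap.mulLeft k y) g.toLinearMap := fun a => by
    simp [hy, eq_comm]
  have h : r ∈ LinearMap.ker (TensorProduct.map f.toLinearMap g.toLinearMap) := hr
  rw [TensorProduct.map_ker hxe hf hye hg] at h
  obtain ⟨_, ⟨r₂, rfl⟩, _, ⟨r₁, rfl⟩, rfl⟩ := Submodule.mem_sup.1 h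
  exact ⟨r₁, r₂, by rw [rTensor_mulLeft_apply, lTensor_mulLeft_apply, add_comm]⟩

/-- If `y` is not a left zero divisor, `(x ⊗ 1)` and `(1 ⊗ y)` are independent: an element `s`
with `(1 ⊗ y) s ∈ (x ⊗ 1) (U ⊗ V)` lies itself in `(x ⊗ 1) (U ⊗ V)`. Indeed `1 ⊗ y` is still injective on `U/xU ⊗ V`, which is where
flatness over the field `k` is used. -/
theorem exists_eq_of_mul_eq_mul {U V U' : Type*} [Ring U] [Algebra k U] [Ring V] [Algebra k V]
    [Ring U'] [Algebra k U'] {f : U →ₐ[k] U'}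
    (hf : Function.Surjective f) {x : U} {y : V}
    (hx : ∀ a, f a = 0 ↔ ∃ b, a = x * b) (hy : IsLeftRegular y)
    {r s : U ⊗[k] V} (h : (1 ⊗ₜ y) * s = (x ⊗ₜ 1) * r) :
    ∃ t, s = (x ⊗ₜ 1) * t := by
  have hxe : Function.Exact (LinearMap.mulLeft k x) f.toLinearMap := fun a => by
    simp [hx, eq_comm]
  have hinj : Function.Injective ((LinearMap.mulLeft k y).lTensor U') :=
    Module.Flat.lTensor_preserves_injective_linearMap _ hy
  have hexact := rTensor_exact V hxe hf
  have h0 : f.toLinearMap.rTensor V s = 0 := by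
    refine (map_eq_zero_iff _ hinj).1 ?_
    have hc : (LinearMap.mulLeft k y).lTensor U' (f.toLinearMap.rTensor V s) =
        f.toLinearMap.rTensor V ((LinearMap.mulLeft k y).lTensor U s) := by
      rw [← LinearMap.comp_apply, ← LinearMap.comp_apply, LinearMap.lTensor_comp_rTensor,
        LinearMap.rTensor_comp_lTensor]
    rw [hc, lTensor_mulLeft_apply, h, ← rTensor_mulLeft_apply]
    exact hexact.apply_apply_eq_zero r
  obtain ⟨t, rfl⟩ := (hexact s).1 h0
  exact ⟨t, rTensor_mulLeft_apply x t⟩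

end Enveloping

/-! ### The connecting map of the reduced augmentation sequence -/

section Resolution

open MulOpposite

/-- `R` is generated by commuting images `l A` and `ρ Aᵒᵖ`, and acts on `A` through left and right
multiplication. This holds for `R = A ⊗ Aᵒᵖ`, and is all that the construction of the connecting
map below uses. -/
structure IsEnvelopingRing {A R : Type v} [Ring A] [Ring R] [Module R A] (l : A →+* R)
    (ρ : Aᵐᵒᵖ →+* R) : Prop where
  comm : ∀ a b, l a * ρ b = ρ b * l a
  mem_closure : ∀ r, r ∈ AddSubmonoid.closure {r | ∃ a b, l a * ρ b = r}
  left_smul : ∀ a c : A, l a • c = a * c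
  right_smul : ∀ b c : A, ρ (op b) • c = c * b

/-- The augmentation `R → A`, `l a * ρ b ↦ a b`. -/
def augmentation (A R : Type v) [Ring A] [Ring R] [Module R A] : R →ₗ[R] A :=
  LinearMap.toSpanSingleton R A 1

/-- For `N` a bimodule and `ker φ = xAᵉ + Aᵉx`, this reads `(ker φ) N = xN + Nx`. -/
theorem mem_ker_smul_iff {R S : Type v} [Ring R] [Ring S] {φ : R →+* S} {y z : R}
    (hker : ∀ r, φ r = 0 ↔ ∃ r₁ r₂, r = y * r₁ + z * r₂)
    {N : Type v} [AddCommGroup N] [Module R N] (n : N) :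
    n ∈ RingHom.ker φ • (⊤ : Submodule R N) ↔
      ∃ n₁ n₂ : N, n = y • n₁ + z • n₂ := by
  constructor
  · intro hn
    induction hn using Submodule.smul_induction_on' with
    | smul r hr n _ =>
      obtain ⟨r₁, r₂, rfl⟩ := (hker r).1 hr
      exact ⟨r₁ • n, r₂ • n, by rw [add_smul, mul_smul, mul_smul]⟩
    | add m _ n _ hm hn =>
      obtain ⟨m₁, m₂, rfl⟩ := hm
      obtain ⟨n₁, n₂, rfl⟩ := hn
      exact ⟨m₁ + n₁, m₂ + n₂, by rw [smul_add, smul_add]; abel⟩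
  · rintro ⟨n₁, n₂, rfl⟩
    exact add_mem
      (Submodule.smul_mem_smul ((hker _).2 ⟨1, 0, by rw [mul_one, mul_zero, add_zero]⟩) trivial)
      (Submodule.smul_mem_smul ((hker _).2 ⟨0, 1, by rw [mul_one, mul_zero, zero_add]⟩) trivial)

variable {A R : Type v} [Ring A] [Ring R] [Module R A] {l : A →+* R} {ρ : Aᵐᵒᵖ →+* R}

theorem augmentation_mul (r s : R) :
    augmentation A R (r * s) = r • augmentation A R s :=
  map_smul (augmentation A R) r s

theorem IsEnvelopingRing.augmentation_left (hR : IsEnvelopingRing l ρ) (a : A) :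
    augmentation A R (l a) = a := by
  rw [augmentation, LinearMap.toSpanSingleton_apply, hR.left_smul, mul_one]

theorem IsEnvelopingRing.augmentation_right (hR : IsEnvelopingRing l ρ) (a : A) :
    augmentation A R (ρ (op a)) = a := by
  rw [augmentation, LinearMap.toSpanSingleton_apply, hR.right_smul, one_mul]

/-- The universal derivation `b ↦ 1 ⊗ b - b ⊗ 1` with values in the kernel `Ω` of the
augmentation. -/
def IsEnvelopingRing.d (hR : IsEnvelopingRing l ρ) (b : A) :
    LinearMap.ker (augmentation A R) :=
  ⟨ρ (op b) - l b, by
    rw [LinearMap.mem_ker, map_sub, hR.augmentation_left, hR.augmentation_right, sub_self]⟩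

theorem IsEnvelopingRing.coe_d (hR : IsEnvelopingRing l ρ) (b : A) :
    (hR.d b : R) = ρ (op b) - l b := rfl

/-- Modulo `xΩ + Ωx`, the class of `c · dx` depends on `c` in a way that is linear on the left and
`α`-semilinear on the right. -/
theorem IsEnvelopingRing.smul_d (hR : IsEnvelopingRing l ρ) {x : A} {α : A ≃+* A}
    (hα : ∀ a, a * x = x * α a) (a b c : A) :
    l (a * c * b) • hR.d x =
      (l (a * c) * l x) • hR.d (α b) - (l (a * c) * ρ (op x)) • hR.d b +
        (l a * ρ (op (α b))) • l c • hR.d x := by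
  apply Subtype.ext
  have h₁ : l b * l x = l x * l (α b) := by rw [← map_mul, hα, map_mul]
  have h₂ : ρ (op x) * ρ (op b) = ρ (op (α b)) * ρ (op x) := by
    rw [← map_mul, ← map_mul, ← op_mul, ← op_mul, hα]
  have h₃ : ρ (op (α b)) * (l c * (ρ (op x) - l x)) =
      l c * (ρ (op x) * ρ (op b)) - l c * (l x * ρ (op (α b))) := by
    rw [h₂, hR.comm x, ← mul_sub_left_distrib, ← mul_sub_left_distrib, ← mul_assoc, ← mul_assoc,
      hR.comm]
  simp only [Submodule.coe_add, Submodule.coe_sub, Submodule.coe_smul, hR.coe_d, smul_eq_mul,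
    map_mul, mul_assoc, h₃]
  simp only [mul_sub, h₁, ← hR.comm b]
  abel

variable {S : Type v} [Ring S] {φ φ' : R →+* S} {x : A}

/-- The map `a ↦ a · dx` from `A` to a reduction of `Ω`; it is semilinear for the action twisted
by `α` on the right. -/
theorem IsEnvelopingRing.exists_connecting_map (hR : IsEnvelopingRing l ρ) {α : A ≃+* A}
    (hα : ∀ a, a * x = x * α a)
    (hker : ∀ r, φ r = 0 ↔ ∃ r₁ r₂, r = l x * r₁ + ρ (op x) * r₂)
    (htw : ∀ a b : A, φ' (l a * ρ (op b)) = φ (l a * ρ (op (α b))))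
    {Q : Type v} [AddCommGroup Q] [Module S Q]
    (q : LinearMap.ker (augmentation A R) →ₛₗ[φ] Q) :
    ∃ θ : A →ₛₗ[φ'] Q, ∀ a : A, θ a = q (l a • hR.d x) := by
  have hφx : φ (l x) = 0 := (hker _).2 ⟨1, 0, by rw [mul_one, mul_zero, add_zero]⟩
  have hφy : φ (ρ (op x)) = 0 := (hker _).2 ⟨0, 1, by rw [mul_one, mul_zero, zero_add]⟩
  let θ : A →+ Q :=
    { toFun := fun a => q (l a • hR.d x)
      map_zero' := by rw [map_zero, zero_smul, map_zero]
      map_add' := fun a b => by rw [map_add, add_smul, map_add] }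
  refine ⟨{ θ with map_smul' := fun r c => ?_ }, fun a => rfl⟩
  change θ (r • c) = φ' r • θ c
  induction hR.mem_closure r using AddSubmonoid.closure_induction with
  | zero => rw [zero_smul, map_zero, map_zero, zero_smul]
  | add r s _ _ hr hs => rw [add_smul, map_add, hr, hs, map_add, add_smul]
  | mem r hr =>
    obtain ⟨a, b, rfl⟩ := hr
    obtain ⟨b, rfl⟩ := op_surjective b
    rw [mul_smul, hR.right_smul, hR.left_smul, ← mul_assoc, htw]
    change q (l (a * c * b) • hR.d x) = φ (l a * ρ (op (α b))) • q (l c • hR.d x)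
    rw [hR.smul_d hα, map_add, map_sub, map_smulₛₗ, map_smulₛₗ, map_mul φ,
      map_mul φ _ (ρ (op x)), hφx, hφy, mul_zero, zero_smul, zero_smul, sub_zero, zero_add, map_smulₛₗ]

/-- Reducing `0 → Ω → A ⊗ Aᵒᵖ → A → 0` modulo `x` on both sides yields an exact sequence whose
kernel term is the reduction of `A` twisted once more by `α`. The hypothesis `hind` says that
`xR ∩ Rx` consists of the elements `x t x`. -/
theorem IsEnvelopingRing.exists_reduction_exact (hR : IsEnvelopingRing l ρ) {α : A ≃+* A}
    (hα : ∀ a, a * x = x * α a) (hx : IsLeftRegular x)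
    (hind : ∀ r s, ρ (op x) * s = l x * r → ∃ t, s = l x * t)
    (hφ : Function.Surjective φ) (hφ' : Function.Surjective φ')
    (hker : ∀ r, φ r = 0 ↔ ∃ r₁ r₂, r = l x * r₁ + ρ (op x) * r₂)
    (hker' : ∀ r, φ' r = 0 ↔ ∃ r₁ r₂, r = l x * r₁ + ρ (op x) * r₂)
    (htw : ∀ a b : A, φ' (l a * ρ (op b)) = φ (l a * ρ (op (α b))))
    {Q₁ Q₀ X X' : Type v} [AddCommGroup Q₁] [Module S Q₁] [AddCommGroup Q₀] [Module S Q₀]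
    [AddCommGroup X] [Module S X] [AddCommGroup X'] [Module S X']
    {q₁ : LinearMap.ker (augmentation A R) →ₛₗ[φ] Q₁} (hq₁ : IsReduction q₁)
    {q₀ : R →ₛₗ[φ] Q₀} (hq₀ : IsReduction q₀)
    {q : A →ₛₗ[φ] X} (hq : IsReduction q)
    {q' : A →ₛₗ[φ'] X'} (hq' : IsReduction q') :
    ∃ (θ : X' →ₗ[S] Q₁) (d : Q₁ →ₗ[S] Q₀) (c : Q₀ →ₗ[S] X),
      Function.Injective θ ∧ Function.Exact θ d ∧ Function.Exact d c ∧ Function.Surjective c ∧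
        ∀ ω, d (q₁ ω) = q₀ ω := by
  obtain ⟨θ₀, hθ₀⟩ := hR.exists_connecting_map hα hker htw q₁
  obtain ⟨θ, hθ⟩ := hq'.exists_lift hφ' θ₀
  obtain ⟨d, hd⟩ := hq₁.exists_lift hφ (q₀ ∘ₛₗ (LinearMap.ker (augmentation A R)).subtype)
  obtain ⟨c, hc⟩ := hq₀.exists_lift hφ (q ∘ₛₗ augmentation A R)
  have hθq (a : A) : θ (q' a) = q₁ (l a • hR.d x) := (hθ _).trans (hθ₀ a)
  have hdq (ω) : d (q₁ ω) = q₀ ω := hd ω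
  have hcq (r) : c (q₀ r) = q (augmentation A R r) := hc r
  have hx' (a : A) : l a * l x = l x * l (α a) := by rw [← map_mul, hα, map_mul]
  refine ⟨θ, d, c, ?_, ?_, ?_, ?_, hdq⟩
  · rw [injective_iff_map_eq_zero]
    intro y hy
    obtain ⟨a, rfl⟩ := hq'.surjective y
    rw [hθq, hq₁.eq_zero_iff, mem_ker_smul_iff hker] at hy
    obtain ⟨ω₁, ω₂, h⟩ := hy
    -- `a · dx = x ω₁ + ω₂ x` rearranges to `(a - ω₂) x = x (ω₁ + α(a))`, so `a - ω₂` is of the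
    -- form `x t`; its augmentation is `a`.
    replace h : l a * (ρ (op x) - l x) = l x * ω₁ + ρ (op x) * ω₂ := congrArg Subtype.val h
    obtain ⟨t, ht⟩ := hind (ω₁ + l (α a)) (l a - ω₂) (by
      rw [mul_sub, mul_add, ← hx', ← hR.comm, sub_eq_iff_eq_add, add_right_comm, ← h]
      noncomm_ring)
    have ha := congrArg (augmentation A R) ht
    rw [map_sub, LinearMap.mem_ker.1 ω₂.2, sub_zero, hR.augmentation_left,
      augmentation_mul] at ha
    rw [hq'.eq_zero_iff, mem_ker_smul_iff hker']
    exact ⟨augmentation A R t, 0, by rw [smul_zero, add_zero]; exact ha⟩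
  · intro y
    obtain ⟨ω, rfl⟩ := hq₁.surjective y
    constructor
    · intro h
      rw [hdq, hq₀.eq_zero_iff, mem_ker_smul_iff hker] at h
      obtain ⟨r₁, r₂, h⟩ := h
      rw [smul_eq_mul, smul_eq_mul] at h
      set a := augmentation A R r₂ with ha
      -- Since `ω ∈ Ω` and `x` is regular, the two summands have augmentations differing by `α`,
      -- so both can be corrected to lie in `Ω`, at the cost of a multiple of `dx`.
      have h₀ : augmentation A R r₁ = -α a := by
        have h' := congrArg (augmentation A R) h
        rw [LinearMap.mem_ker.1 ω.2, map_add, augmentation_mul, augmentation_mul, hR.left_smul,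
          hR.right_smul, ← ha, hα, ← mul_add] at h'
        exact eq_neg_of_add_eq_zero_left (hx (h'.symm.trans (mul_zero x).symm))
      let ω₁ : LinearMap.ker (augmentation A R) := ⟨r₁ + l (α a), by
        rw [LinearMap.mem_ker, map_add, hR.augmentation_left, h₀, neg_add_cancel]⟩
      let ω₂ : LinearMap.ker (augmentation A R) := ⟨r₂ - l a, by
        rw [LinearMap.mem_ker, map_sub, hR.augmentation_left, sub_self]⟩
      have hω : ω = (l x • ω₁ + ρ (op x) • ω₂) + l a • hR.d x := by
        apply Subtype.ext
        change (ω : R) = (l x * (r₁ + l (α a)) + ρ (op x) * (r₂ - l a)) +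
          l a * (ρ (op x) - l x)
        rw [h, mul_add, mul_sub, mul_sub, hx', hR.comm]
        abel
      refine ⟨q' a, ?_⟩
      rw [hθq, hω, map_add q₁ (_ + _),
        (hq₁.eq_zero_iff _).2 ((mem_ker_smul_iff hker _).2 ⟨ω₁, ω₂, rfl⟩), zero_add]
    · rintro ⟨z, hz⟩
      obtain ⟨a, rfl⟩ := hq'.surjective z
      rw [← hz, hθq, hdq, hq₀.eq_zero_iff, mem_ker_smul_iff hker]
      refine ⟨-l (α a), l a, ?_⟩
      change l a * (ρ (op x) - l x) = l x * -l (α a) + ρ (op x) * l a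
      rw [mul_sub, hx', hR.comm, mul_neg, neg_add_eq_sub]
  · intro y
    obtain ⟨r, rfl⟩ := hq₀.surjective y
    constructor
    · intro h
      rw [hcq, hq.eq_zero_iff, mem_ker_smul_iff hker] at h
      obtain ⟨a₁, a₂, h⟩ := h
      let ω : LinearMap.ker (augmentation A R) := ⟨r - (l x * l a₁ + ρ (op x) * l a₂), by
        rw [LinearMap.mem_ker, map_sub, map_add, augmentation_mul, augmentation_mul,
          hR.augmentation_left, hR.augmentation_left, h, sub_self]⟩
      refine ⟨q₁ ω, ?_⟩
      rw [hdq]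
      change q₀ (r - _) = q₀ r
      rw [map_sub, sub_eq_self, hq₀.eq_zero_iff, mem_ker_smul_iff hker]
      exact ⟨l a₁, l a₂, rfl⟩
    · rintro ⟨z, hz⟩
      obtain ⟨ω, rfl⟩ := hq₁.surjective z
      rw [← hz, hdq, hcq, LinearMap.mem_ker.1 ω.2, map_zero]
  · intro y
    obtain ⟨a, rfl⟩ := hq.surjective y
    exact ⟨q₀ (l a), by rw [hcq, hR.augmentation_left]⟩

end Resolution

/-! ### Restriction and twisting of bimodules as restriction of scalars -/

section Bimodules

open MulOpposite

variable {k : Type u} [Field k] {A B : Type v} [Ring A] [Algebra k A] [Ring B] [Algebra k B]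

instance restrictBimod_linear (f g : A →ₐ[k] B) : (restrictBimod f g).Linear k where
  map_smul {M M'} h r := by
    ext m
    change (algebraMap k (Env k B) r) • h m =
      Algebra.TensorProduct.map f (AlgHom.op g) (algebraMap k (Env k A) r) • h m
    rw [AlgHom.commutes]

instance restrictBimod_additive (f g : A →ₐ[k] B) : (restrictBimod f g).Additive :=
  inferInstanceAs (ModuleCat.restrictScalars _).Additive

instance restrictBimod_preservesEpimorphisms (f g : A →ₐ[k] B) :
    (restrictBimod f g).PreservesEpimorphisms where
  preserves h _ := (ModuleCat.epi_iff_surjective _).2 ((ModuleCat.epi_iff_surjective h).1 ‹_›)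

theorem isEnvelopingRing_env :
    letI := regularModule k A
    IsEnvelopingRing (Algebra.TensorProduct.includeLeft : A →ₐ[k] Env k A).toRingHom
      (Algebra.TensorProduct.includeRight : Aᵐᵒᵖ →ₐ[k] Env k A).toRingHom :=
  letI := regularModule k A
  { comm := fun a b => by simp
    mem_closure := fun r => by
      induction r using TensorProduct.induction_on with
      | zero => exact zero_mem _
      | tmul a b => exact AddSubmonoid.subset_closure ⟨a, b, by simp⟩
      | add r s hr hs => exact add_mem hr hs
    left_smul := fun a c => (regularModule_smul k A a 1 c).trans (mul_one _)
    right_smul := fun b c => (regularModule_smul k A 1 b c).trans (by rw [one_mul]) }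

/-- The functor from `B`-bimodules to `A`-bimodules which twists by `σ` and restricts along `π`. -/
noncomputable abbrev twistRes (π : A →ₐ[k] B) (σ : B ≃ₐ[k] B) : Bimod k B ⥤ Bimod k A :=
  twist σ ⋙ resBimod π

/-- The map `Aᵉ → Bᵉ` along which `twistRes π σ` restricts scalars. -/
noncomputable def envMap (π : A →ₐ[k] B) (σ : B ≃ₐ[k] B) : Env k A →+* Env k B :=
  (Algebra.TensorProduct.map (AlgHom.id k B) (AlgHom.op σ.toAlgHom)).toRingHom.comp
    (Algebra.TensorProduct.map π (AlgHom.op π)).toRingHom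

theorem envMap_tmul (π : A →ₐ[k] B) (σ : B ≃ₐ[k] B) (a b : A) :
    envMap π σ (a ⊗ₜ op b) = π a ⊗ₜ op (σ (π b)) := rfl

theorem envMap_surjective {π : A →ₐ[k] B} (hπ : Function.Surjective π) (σ : B ≃ₐ[k] B) :
    Function.Surjective (envMap π σ) := by
  have h : Function.Surjective (AlgHom.op π) := fun b => by
    obtain ⟨a, ha⟩ := hπ b.unop
    exact ⟨op a, congrArg op ha⟩
  have h' : Function.Surjective (AlgHom.op σ.toAlgHom) := fun b =>
    ⟨op (σ.symm b.unop), congrArg op (σ.apply_symm_apply _)⟩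
  exact (TensorProduct.map_surjective Function.surjective_id h').comp
    (TensorProduct.map_surjective hπ h)

theorem envMap_eq_zero_iff {π : A →ₐ[k] B} (hπ : Function.Surjective π) (σ : B ≃ₐ[k] B)
    {x : A} (hl : ∀ a, π a = 0 ↔ ∃ b, a = x * b) (hr : ∀ a, π a = 0 ↔ ∃ b, a = b * x)
    (r : Env k A) : envMap π σ r = 0 ↔ ∃ r₁ r₂, r = (x ⊗ₜ 1) * r₁ + (1 ⊗ₜ op x) * r₂ := by
  constructor
  · intro h
    refine exists_eq_of_map_eq_zero (f := π) (g := (AlgHom.op σ.toAlgHom).comp (AlgHom.op π)) hπ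
      (fun b => ?_) hl (fun b => ?_) ?_
    · obtain ⟨a, ha⟩ := hπ (σ.symm b.unop)
      exact ⟨op a, congrArg op ((congrArg σ ha).trans (σ.apply_symm_apply _))⟩
    · have h₁ : AlgHom.op σ.toAlgHom (AlgHom.op π b) = 0 ↔ π b.unop = 0 := by
        change op (σ (π b.unop)) = 0 ↔ _
        rw [op_eq_zero_iff, map_eq_zero_iff σ σ.injective]
      refine h₁.trans ((hr b.unop).trans ⟨?_, ?_⟩)
      · rintro ⟨c, hc⟩
        exact ⟨op c, unop_injective hc⟩
      · rintro ⟨c, hc⟩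
        exact ⟨c.unop, congrArg unop hc⟩
    · have := Algebra.TensorProduct.map_comp (AlgHom.id k B) π (AlgHom.op σ.toAlgHom) (AlgHom.op π)
      rw [AlgHom.id_comp] at this
      rw [this]
      exact h
  · rintro ⟨r₁, r₂, rfl⟩
    have hx : π x = 0 := (hl x).2 ⟨1, (mul_one x).symm⟩
    have h₁ : envMap π σ (x ⊗ₜ 1) = 0 := by
      refine (envMap_tmul π σ x 1).trans ?_
      rw [hx, TensorProduct.zero_tmul]
    have h₂ : envMap π σ (1 ⊗ₜ op x) = 0 := by
      refine (envMap_tmul π σ 1 x).trans ?_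
      rw [hx, map_zero, op_zero, TensorProduct.tmul_zero]
    rw [map_add, map_mul, map_mul, h₁, h₂, zero_mul, zero_mul, add_zero]

/-- Morphisms to `twistRes π σ M` are semilinear maps over `envMap π σ`. -/
noncomputable def homOfSemilinear {π : A →ₐ[k] B} {σ : B ≃ₐ[k] B} {N : Bimod k A} {Q : Bimod k B}
    (q : N →ₛₗ[envMap π σ] Q) : N ⟶ (twistRes π σ).obj Q :=
  ModuleCat.ofHom (Y := (twistRes π σ).obj Q)
    { toFun := q, map_add' := map_add q, map_smul' := map_smulₛₗ q }

theorem IsReduction.isUniversalArrow {π : A →ₐ[k] B} (hπ : Function.Surjective π) {σ : B ≃ₐ[k] B}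
    {N : Bimod k A} {Q : Bimod k B} {q : N →ₛₗ[envMap π σ] Q} (hq : IsReduction q) :
    IsUniversalArrow (twistRes π σ) (homOfSemilinear q) := by
  intro M
  constructor
  · intro f f' h
    ext y
    obtain ⟨n, rfl⟩ := hq.surjective y
    exact ConcreteCategory.congr_hom h n
  · intro f
    let f' : N →ₛₗ[envMap π σ] M :=
      { toFun := f.hom, map_add' := map_add f.hom, map_smul' := map_smul f.hom }
    obtain ⟨g, hg⟩ := hq.exists_lift (envMap_surjective hπ σ) f'
    exact ⟨ModuleCat.ofHom g, by ext n; exact hg n⟩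

end Bimodules

/-! ### The twisted resolution -/

section TwistedResolution

open MulOpposite

variable {k : Type u} [Field k] {A B : Type v} [Ring A] [Algebra k A] [Ring B] [Algebra k B]

variable (k A) in
/-- The short exact sequence `0 → Ω → Aᵉ → A → 0` of bimodules. -/
noncomputable def augmentationComplex : ShortComplex (Bimod k A) :=
  letI := regularModule k A
  (augmentation A (Env k A)).shortComplexKer

theorem augmentationComplex_shortExact : (augmentationComplex k A).ShortExact :=
  letI := regularModule k A
  LinearMap.shortExact_shortComplexKer fun a =>
    ⟨_, (isEnvelopingRing_env (k := k)).augmentation_left a⟩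

instance : Projective (augmentationComplex k A).X₂ :=
  (IsProjective.iff_projective (Env k A)).1 inferInstance

theorem projective_augmentationComplex_X₁ (hpd : HasProjectiveDimensionLE (regularBimod k A) 1) :
    Projective (augmentationComplex k A).X₁ :=
  projective_iff_hasProjectiveDimensionLT_one.2
    (augmentationComplex_shortExact.hasProjectiveDimensionLT_X₁ 1 inferInstance hpd)

/-- The exact sequence `0 → X' → Q₁ → Q₀ → X → 0` of `B`-bimodules, where `X`, `Q₀`, `Q₁` are the
reductions of `A`, `Aᵉ`, `Ω` for the twist `τ`, and `X'` is the reduction of `A` for the next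
twist `τ'`. -/
theorem exists_twisted_resolution (hpd : HasProjectiveDimensionLE (regularBimod k A) 1)
    {x : A} (hx : IsRegular x) {α : A ≃ₐ[k] A} (hα : ∀ a, a * x = x * α a)
    {π : A →ₐ[k] B} (hπ : Function.Surjective π) (hker : ∀ a, π a = 0 ↔ ∃ b, a = x * b)
    {τ τ' : B ≃ₐ[k] B} (hτ : ∀ a, τ' (π a) = τ (π (α a)))
    {X X' : Bimod k B} {q : regularBimod k A →ₛₗ[envMap π τ] X} (hq : IsReduction q)
    {q' : regularBimod k A →ₛₗ[envMap π τ'] X'} (hq' : IsReduction q') :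
    ∃ (Q₀ Q₁ K : Bimod k B) (_ : Projective Q₀) (_ : Projective Q₁) (a : X' ⟶ Q₁) (b : Q₁ ⟶ K)
      (i : K ⟶ Q₀) (c : Q₀ ⟶ X) (hab : a ≫ b = 0) (hic : i ≫ c = 0)
      (ηΩ : (augmentationComplex k A).X₁ ⟶ (twistRes π τ).obj Q₁)
      (ηP : (augmentationComplex k A).X₂ ⟶ (twistRes π τ).obj Q₀),
      (ShortComplex.mk a b hab).ShortExact ∧ (ShortComplex.mk i c hic).ShortExact ∧
      IsUniversalArrow (twistRes π τ) ηΩ ∧ IsUniversalArrow (twistRes π τ) ηP ∧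
      (augmentationComplex k A).f ≫ ηP = ηΩ ≫ (twistRes π τ).map (b ≫ i) := by
  let := regularModule k A
  have hker' (a : A) : π a = 0 ↔ ∃ b, a = b * x := by
    refine (hker a).trans ⟨?_, ?_⟩
    · rintro ⟨b, rfl⟩
      exact ⟨α.symm b, by rw [hα, α.apply_symm_apply]⟩
    · rintro ⟨b, rfl⟩
      exact ⟨α b, hα b⟩
  obtain ⟨Q₁, q₁, hq₁⟩ := exists_isReduction (envMap_surjective hπ τ)
    (LinearMap.ker (augmentation A (Env k A)))
  obtain ⟨Q₀, q₀, hq₀⟩ := exists_isReduction (envMap_surjective hπ τ) (Env k A)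
  have hind (r s : Env k A) (h : (1 ⊗ₜ op x) * s = (x ⊗ₜ 1) * r) : ∃ t, s = (x ⊗ₜ 1) * t := by
    refine exists_eq_of_mul_eq_mul hπ hker (fun c d hcd => ?_) h
    exact unop_injective (hx.right (congrArg unop hcd))
  obtain ⟨θ, d, c, hθ, hθd, hdc, hc, hcomm⟩ :=
    (isEnvelopingRing_env (k := k) (A := A)).exists_reduction_exact (α := α.toRingEquiv) hα hx.left
      hind (envMap_surjective hπ τ) (envMap_surjective hπ τ')
      (envMap_eq_zero_iff hπ τ hker hker') (envMap_eq_zero_iff hπ τ' hker hker')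
      (fun a b => by
        change envMap π τ' ((a ⊗ₜ op 1) * (1 ⊗ₜ op b)) =
          envMap π τ ((a ⊗ₜ op 1) * (1 ⊗ₜ op (α b)))
        simp only [Algebra.TensorProduct.tmul_mul_tmul, ← op_mul, mul_one]
        rw [envMap_tmul, envMap_tmul, hτ])
      hq₁ hq₀ hq hq'
  have hΩ : IsUniversalArrow (twistRes π τ) (homOfSemilinear
    (N := (augmentationComplex k A).X₁) q₁) := IsReduction.isUniversalArrow hπ hq₁
  have hP : IsUniversalArrow (twistRes π τ) (homOfSemilinear
    (N := (augmentationComplex k A).X₂) q₀) := IsReduction.isUniversalArrow hπ hq₀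
  have := projective_augmentationComplex_X₁ hpd
  refine ⟨Q₀, Q₁, ModuleCat.of _ (LinearMap.range d), hP.projective, hΩ.projective,
    ModuleCat.ofHom θ, ModuleCat.ofHom d.rangeRestrict, ModuleCat.ofHom (LinearMap.range d).subtype,
    ModuleCat.ofHom c, ?_, ?_, homOfSemilinear (N := (augmentationComplex k A).X₁) q₁,
    homOfSemilinear (N := (augmentationComplex k A).X₂) q₀, ?_, ?_, hΩ, hP, ?_⟩
  · ext y
    exact hθd.apply_apply_eq_zero y
  · ext ⟨_, y, rfl⟩
    exact hdc.apply_apply_eq_zero y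
  · refine ModuleCat.shortComplex_shortExact _ (fun y => ?_) hθ d.surjective_rangeRestrict
    exact (Subtype.ext_iff).trans (hθd y)
  · refine ModuleCat.shortComplex_shortExact _ (fun y => (hdc y).trans ?_)
      (LinearMap.range d).injective_subtype hc
    exact ⟨fun ⟨z, hz⟩ => ⟨⟨y, z, hz⟩, rfl⟩, fun ⟨z, hz⟩ => hz ▸ z.2⟩
  · ext ω
    exact (hcomm ω).symm

/-- `B` is the reduction of `A` without twist. -/
theorem exists_isReduction_regularBimod {x : A}
    {π : A →ₐ[k] B} (hπ : Function.Surjective π) (hker : ∀ a, π a = 0 ↔ ∃ b, a = x * b) :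
    ∃ q : regularBimod k A →ₛₗ[envMap π 1] regularBimod k B, IsReduction q := by
  let := regularModule k A
  let := regularModule k B
  let q : A →ₛₗ[envMap π (1 : B ≃ₐ[k] B)] B :=
    { toFun := π
      map_add' := map_add π
      map_smul' := fun r c => by
        induction r using TensorProduct.induction_on with
        | zero =>
          refine ((congrArg π (zero_smul (Env k A) c)).trans (map_zero π)).trans ?_
          exact ((congrArg (· • π c) (map_zero (envMap π 1))).trans (zero_smul (Env k B) (π c))).symm
        | add r s hr hs => rw [add_smul, map_add, hr, hs, map_add, add_smul]
        | tmul a b =>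
          obtain ⟨b, rfl⟩ := op_surjective b
          rw [regularModule_smul, envMap_tmul, regularModule_smul, map_mul, map_mul]
          rfl }
  refine ⟨q, hπ, fun (a : A) (ha : π a = 0) => ?_⟩
  obtain ⟨b, rfl⟩ := (hker a).1 ha
  have hx : π x = 0 := (hker x).2 ⟨1, (mul_one x).symm⟩
  have hx' : envMap π (1 : B ≃ₐ[k] B) (x ⊗ₜ op 1) = 0 := by
    rw [envMap_tmul, hx, TensorProduct.zero_tmul]
  have h (c : regularBimod k A) : (x ⊗ₜ op 1 : Env k A) • c ∈
      RingHom.ker (envMap π (1 : B ≃ₐ[k] B)) • (⊤ : Submodule (Env k A) (regularBimod k A)) :=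
    Submodule.smul_mem_smul hx' trivial
  have hb : (x ⊗ₜ[k] op 1 : Env k A) • b = x * b :=
    (regularModule_smul k A x 1 b).trans (mul_one _)
  exact hb ▸ h b

end TwistedResolution

end HochschildNormal

open HochschildNormal in
theorem mainTheorem10 {k : Type u} [Field k] {A : Type v} [Ring A] [Algebra k A]
    (hpd : HasProjectiveDimensionLE (regularBimod k A) 1)
    (x : A) (hnormal : IsNormalElement x) (hx : IsRegular x)
    (α : A ≃ₐ[k] A) (hα : ∀ a, a * x = x * α a) (p : ℕ) :
    ∃ (f : hochschild k (NormalQuotient x) (2 * p + 1) ⟶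
          twist (inducedAut x hx α hα ^ p) ⋙ resBimod (proj k x) ⋙ hochschild k A 1)
      (e : twist (inducedAut x hx α hα ^ p) ⋙ resBimod (proj k x) ⋙ hochschild k A 1 ⟶
          twist (inducedAut x hx α hα ^ (p + 1)) ⋙ resBimod (proj k x) ⋙ hochschild k A 0)
      (g : twist (inducedAut x hx α hα ^ (p + 1)) ⋙ resBimod (proj k x) ⋙ hochschild k A 0 ⟶
          hochschild k (NormalQuotient x) (2 * p + 2)),
      ∀ M : Bimod k (NormalQuotient x),
        Function.Injective (f.app M) ∧
        Function.Exact (f.app M) (e.app M) ∧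
        Function.Exact (e.app M) (g.app M) ∧
        Function.Surjective (g.app M) := by
  let B := NormalQuotient x
  let σ : B ≃ₐ[k] B := inducedAut x hx α hα
  let π : A →ₐ[k] B := proj k x
  have hπ : Function.Surjective π := proj_surjective x
  have hker (a : A) : π a = 0 ↔ ∃ b, a = x * b := proj_eq_zero_iff hα a
  have hσ (n : ℕ) (a : A) : (σ ^ (n + 1)) (π a) = (σ ^ n) (π (α a)) := by
    rw [pow_succ]
    rfl
  -- `X n` is the reduction of `A` for the twist `σ ^ n`, chosen to be `B` itself for `n = 0`.
  have hX (n : ℕ) : ∃ X : Bimod k B, (n = 0 → X = regularBimod k B) ∧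
      ∃ q : regularBimod k A →ₛₗ[envMap π (σ ^ n)] X, IsReduction q := by
    obtain _ | n := n
    · exact ⟨_, fun _ => rfl, exists_isReduction_regularBimod hπ hker⟩
    · obtain ⟨X, h⟩ := exists_isReduction (envMap_surjective hπ (σ ^ (n + 1))) (regularBimod k A)
      exact ⟨X, fun h => absurd h n.succ_ne_zero, h⟩
  choose X hX₀ q hq using hX
  have hshift (n : ℕ) : ∀ m : ℕ, 1 ≤ m → ∃ s : extFunctor k (X n) m ⟶
      extFunctor k (regularBimod k B) (2 * n + m), ∀ M, Function.Bijective (s.app M) := by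
    induction n with
    | zero =>
      intro m _
      rw [hX₀ 0 rfl, mul_zero, zero_add]
      exact ⟨𝟙 _, fun M => Function.bijective_id⟩
    | succ n ih =>
      intro m hm
      obtain ⟨Q₀, Q₁, K, _, _, a, b, i, c, hab, hic, -, -, h₂, h₁, -⟩ :=
        exists_twisted_resolution hpd hx hα hπ hker (hσ n) (hq n) (hq (n + 1))
      obtain ⟨s, hs⟩ := exists_extFunctor_shift (k := k) h₂ h₁ hm
      obtain ⟨t, ht⟩ := ih (m + 2) (by lia)
      rw [show 2 * (n + 1) + m = 2 * n + (m + 2) by lia]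
      exact ⟨s ≫ t, fun M => (ht M).comp (hs M)⟩
  obtain ⟨Q₀, Q₁, K, _, _, a, b, i, c, hab, hic, ηΩ, ηP, h₂, h₁, hΩ, hP, hcomm⟩ :=
    exists_twisted_resolution hpd hx hα hπ hker (hσ p) (hq p) (hq (p + 1))
  obtain ⟨f, e, g, h⟩ := exists_fourTermSequence (k := k) augmentationComplex_shortExact h₂ h₁ hΩ hP
    (ηN := homOfSemilinear (q (p + 1))) (IsReduction.isUniversalArrow hπ (hq (p + 1))) hcomm
  obtain ⟨s, hs⟩ := hshift p 1 le_rfl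
  obtain ⟨t, ht⟩ := hshift p 2 (by lia)
  obtain ⟨s', hs'⟩ := exists_natTrans_inverse s hs
  have hs'_bij (M) : Function.Bijective (s'.app M) :=
    ⟨(hs' M).2.injective, (hs' M).1.surjective⟩
  refine ⟨s' ≫ f, e, g ≫ t, fun M => ?_⟩
  obtain ⟨hf, hfe, heg, hg⟩ := h M
  refine ⟨hf.comp (hs'_bij M).1, fun y => (hfe y).trans ?_, fun y => ?_, (ht M).2.comp hg⟩
  · exact ((hs'_bij M).2.exists (p := fun z => f.app M z = y))
  · exact (map_eq_zero_iff (t.app M).hom (ht M).1).trans (heg y)
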